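/- **Theorem 3.3 (Ando–Horn–Johnson inequality).** For an $n\times n$ complex matrix $Z$, let $\sigma_1(Z)\ge\cdots\ge\sigma_n(Z)$ denote its singular values in decreasing order (with multiplicity), and let $c_1(Z)\ge\cdots\ge c_n(Z)$ denote the Euclidean lengths of its columns arranged in decreasing order. Let $\circ$ denote the Hadamard (entrywise) product, $(A\circ B)_{ij}=a_{ij}b_{ij}$. Let $A$, $B$, $X$, $Y$ be $n\times n$ complex matrices with $A=X^*Y$. Then $$\sum_{i=1}^k \sigma_i(A\circ B)\ \le\ \sum_{i=1}^k c_i(X)\,c_i(Y)\,\sigma_i(B)\qquad\text{for all } 1\le k\le n.$$ -/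

import Mathlib

open scoped Matrix

/-- The singular values `σ₁(A) ≥ ⋯ ≥ σₙ(A)` of a complex `n × n` matrix, in decreasing order with
multiplicity: the singular values of `A` as an operator on `ℂⁿ` with the standard inner product.
The index starts at zero, so `matrixSingularValue A i` is `σ_{i+1}(A)`. -/
noncomputable def matrixSingularValue {n : ℕ} (A : Matrix (Fin n) (Fin n) ℂ) (i : Fin n) : ℝ :=
  (Matrix.toEuclideanLin A).singularValues i

/-- The Euclidean length of the `j`-th column of `Z`. -/
noncomputable def columnLength {n : ℕ} (Z : Matrix (Fin n) (Fin n) ℂ) (j : Fin n) : ℝ :=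
  ‖WithLp.toLp 2 (fun i => Z i j)‖

/-- The column lengths `c₁(Z) ≥ ⋯ ≥ cₙ(Z)` of `Z` in decreasing order: sort the columns by the
negatives of their lengths in increasing order. The index starts at zero, so
`orderedColumnLength Z i` is `c_{i+1}(Z)`. -/
noncomputable def orderedColumnLength {n : ℕ} (Z : Matrix (Fin n) (Fin n) ℂ) (i : Fin n) : ℝ :=
  columnLength Z (Tuple.sort (fun j => -columnLength Z j) i)

theorem columnLength_eq {n : ℕ} (Z : Matrix (Fin n) (Fin n) ℂ) (j : Fin n) :
    columnLength Z j = √(∑ i, ‖Z i j‖ ^ 2) := by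
  simp [columnLength, EuclideanSpace.norm_eq]

theorem orderedColumnLength_antitone {n : ℕ} (Z : Matrix (Fin n) (Fin n) ℂ) :
    Antitone (orderedColumnLength Z) := by
  intro i j hij
  have h := Tuple.monotone_sort (fun j => -columnLength Z j) hij
  simpa [orderedColumnLength] using h

/-! Both sides are expanded in layers. Normalizing columns gives `A a b = |X_a| |Y_b| G a b`, where
`G` is built from columns of length at most one; an SVD writes `B` as a sum of rank-one terms; and
the sum of the first `k` singular values of `A ⊙ B` is a trace pairing with a truncated unitary
product. It is thus trilinear in the column lengths of `X`, those of `Y` and the singular values of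
`B`. Each of these sequences is a nonnegative combination of indicators: of sets of longest columns,
or of initial segments. With the same coefficients, the right-hand side becomes a sum of minima of
four cardinalities (`card_diagonal_layers`), so the claim reduces to bounding each `truncatedForm`
by that minimum (`norm_truncatedForm_le_min`). Two bounds, by rows and by rank, give all four by
symmetry. -/

/-- The first `p` elements of `Fin n`. -/
def initialSegment (n p : ℕ) : Finset (Fin n) := {i | i.val < p}

theorem mem_initialSegment {n p : ℕ} {i : Fin n} : i ∈ initialSegment n p ↔ i.val < p := by
  simp [initialSegment]

theorem initialSegment_inter (n p q : ℕ) :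
    initialSegment n p ∩ initialSegment n q = initialSegment n (min p q) := by
  ext i; simp [mem_initialSegment]

/-- An antitone nonnegative function on `Fin n` is a nonnegative combination of indicators of
initial segments. -/
theorem exists_layer_decomposition {n : ℕ} (f : Fin n → ℝ) (hf : Antitone f) (h0 : ∀ i, 0 ≤ f i) :
    ∃ δ : ℕ → ℝ, (∀ p, 0 ≤ δ p) ∧
      ∀ i, f i = ∑ p ∈ Finset.range n, if i ∈ initialSegment n (p + 1) then δ p else 0 := by
  -- Extension by zero makes the last difference equal to the last value of `f`, and the telescoping
  -- sum end at `F n = 0`.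
  set F : ℕ → ℝ := fun m => if h : m < n then f ⟨m, h⟩ else 0 with hF
  refine ⟨fun p => F p - F (p + 1), fun p => ?_, fun i => ?_⟩
  · simp only [hF]
    split_ifs with h1 h2
    · exact sub_nonneg.2 (hf (by simp))
    · simpa using h0 _
    · omega
    · simp
  · have hfil : (Finset.range n).filter (fun p => i ∈ initialSegment n (p + 1)) =
        Finset.Ico i.val n := by
      ext p; simp [mem_initialSegment]; omega
    rw [← Finset.sum_filter, hfil]
    have h := Finset.sum_Ico_sub F i.isLt.le
    have h1 : ∑ p ∈ Finset.Ico i.val n, (F p - F (p + 1)) = F i - F n := by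
      rw [← neg_inj, ← Finset.sum_neg_distrib]; simpa using h
    rw [h1]; simp [hF]

/-! ### Singular value decomposition -/

/-- An eigenbasis `v` of `T* T` has orthogonal images of lengths `σ i`. The nonzero images,
normalized, extend to the basis `u`; where `σ i = 0` the image itself vanishes. -/
theorem exists_singularValue_bases {n : ℕ} (B : Matrix (Fin n) (Fin n) ℂ) :
    ∃ u v : OrthonormalBasis (Fin n) ℂ (EuclideanSpace ℂ (Fin n)),
      ∀ i, Matrix.toEuclideanLin B (v i) = (matrixSingularValue B i : ℂ) • u i := by
  set T := Matrix.toEuclideanLin B with hT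
  have hn : Module.finrank ℂ (EuclideanSpace ℂ (Fin n)) = n := by simp
  set hs := T.isSymmetric_adjoint_mul_self
  set v := hs.eigenvectorBasis hn
  have hσ : ∀ i, (hs.eigenvalues hn i) = matrixSingularValue B i ^ 2 := fun i =>
    (T.sq_singularValues_fin hn i).symm
  have hin : ∀ i j, inner ℂ (T (v i)) (T (v j)) =
      if i = j then ((matrixSingularValue B i : ℂ)) ^ 2 else 0 := by
    intro i j
    rw [← LinearMap.adjoint_inner_right]
    have h := hs.apply_eigenvectorBasis hn j
    have h2 : T.adjoint (T (v j)) = ((matrixSingularValue B j : ℂ) ^ 2) • v j := by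
      rw [hσ] at h
      calc T.adjoint (T (v j)) = _ := h
        _ = _ := by push_cast; rfl
    rw [h2, inner_smul_right, v.inner_eq_ite]
    split_ifs with hij
    · simp [hij]
    · simp
  set s : Set (Fin n) := {i | matrixSingularValue B i ≠ 0}
  have ho : Orthonormal ℂ (s.domRestrict fun i => ((matrixSingularValue B i : ℂ)⁻¹) • T (v i)) := by
    rw [orthonormal_iff_ite]
    rintro ⟨i, hi⟩ ⟨j, hj⟩
    have hi' : (matrixSingularValue B i : ℂ) ≠ 0 := by exact_mod_cast hi
    simp only [Set.domRestrict_apply, inner_smul_left, inner_smul_right, hin, Subtype.mk.injEq]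
    split_ifs with hij
    · subst hij
      simp
      field_simp
    · simp
  obtain ⟨u, hu⟩ := ho.exists_orthonormalBasis_extension_of_card_eq (by simp)
  refine ⟨u, v, fun i => ?_⟩
  by_cases hi : matrixSingularValue B i = 0
  · have h := hin i i
    simp only [hi, if_true] at h
    simpa [hi] using h
  · rw [hu i hi, smul_smul, mul_inv_cancel₀ (by exact_mod_cast hi), one_smul]

theorem orthonormalBasis_mem_unitary {n : ℕ}
    (u : OrthonormalBasis (Fin n) ℂ (EuclideanSpace ℂ (Fin n))) :
    (Matrix.of fun a i => u i a) ∈ Matrix.unitaryGroup (Fin n) ℂ := by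
  rw [Matrix.mem_unitaryGroup_iff']
  ext i j
  have h := u.inner_eq_ite i j
  simp only [PiLp.inner_apply, RCLike.inner_apply] at h
  simp only [Matrix.mul_apply, Matrix.star_apply, Matrix.of_apply, Matrix.one_apply]
  rw [← h]
  exact Finset.sum_congr rfl fun a _ => by rw [mul_comm]; rfl

theorem map_star_mem_unitary {n : ℕ} {U : Matrix (Fin n) (Fin n) ℂ}
    (hU : U ∈ Matrix.unitaryGroup (Fin n) ℂ) : U.map star ∈ Matrix.unitaryGroup (Fin n) ℂ := by
  rw [Matrix.mem_unitaryGroup_iff'] at hU ⊢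
  have h := congrArg (fun M => M.map star) hU
  ext i j
  have h := congrFun (congrFun h i) j
  simp only [Matrix.map_apply, Matrix.mul_apply, Matrix.star_apply, star_sum, star_mul'] at h
  simp only [Matrix.map_apply, Matrix.mul_apply, Matrix.star_apply, h, Matrix.one_apply]
  split_ifs <;> simp

theorem transpose_mem_unitary {n : ℕ} {U : Matrix (Fin n) (Fin n) ℂ}
    (hU : U ∈ Matrix.unitaryGroup (Fin n) ℂ) : Uᵀ ∈ Matrix.unitaryGroup (Fin n) ℂ := by
  have h := map_star_mem_unitary (Unitary.star_mem hU)
  convert h using 1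
  ext i j; simp [Matrix.star_apply]

/-- Singular value decomposition. The second unitary is transposed, not conjugate transposed. -/
theorem exists_svd {n : ℕ} (B : Matrix (Fin n) (Fin n) ℂ) :
    ∃ U ∈ Matrix.unitaryGroup (Fin n) ℂ, ∃ V ∈ Matrix.unitaryGroup (Fin n) ℂ,
      B = U * Matrix.diagonal (fun i => (matrixSingularValue B i : ℂ)) * Vᵀ := by
  obtain ⟨u, v, h⟩ := exists_singularValue_bases B
  refine ⟨_, orthonormalBasis_mem_unitary u, _,
    map_star_mem_unitary (orthonormalBasis_mem_unitary v), ?_⟩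
  have hv := orthonormalBasis_mem_unitary v
  set V := Matrix.of fun a i => v i a
  have hVs : (V.map star)ᵀ = star V := rfl
  have key : B * V = (Matrix.of fun a i => u i a) *
      Matrix.diagonal (fun i => (matrixSingularValue B i : ℂ)) := by
    ext a i
    have h1 := congrArg (fun x : EuclideanSpace ℂ (Fin n) => x a) (h i)
    rw [Matrix.mul_diagonal, Matrix.of_apply, mul_comm]
    simpa [Matrix.mul_apply, Matrix.toLpLin_apply, Matrix.mulVec, dotProduct, V] using h1
  rw [hVs, ← key, mul_assoc, (Matrix.mem_unitaryGroup_iff).1 hv, mul_one]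

/-! ### Euclidean norms under unitaries and their truncations -/

theorem sum_sq_norm_mulVec {n : ℕ} {U : Matrix (Fin n) (Fin n) ℂ}
    (hU : U ∈ Matrix.unitaryGroup (Fin n) ℂ) (x : Fin n → ℂ) :
    ∑ i, ‖∑ j, U i j * x j‖ ^ 2 = ∑ j, ‖x j‖ ^ 2 := by
  have h : star (U *ᵥ x) ⬝ᵥ (U *ᵥ x) = star x ⬝ᵥ x := by
    rw [Matrix.star_mulVec, ← Matrix.dotProduct_mulVec, Matrix.mulVec_mulVec,
      ← Matrix.star_eq_conjTranspose, (Matrix.mem_unitaryGroup_iff').1 hU, Matrix.one_mulVec]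
  have h2 : ∀ y : Fin n → ℂ, star y ⬝ᵥ y = ((∑ i, ‖y i‖ ^ 2 : ℝ) : ℂ) := by
    intro y
    simp only [dotProduct, Pi.star_apply]
    push_cast
    exact Finset.sum_congr rfl fun i _ => Complex.conj_mul' (y i)
  rw [h2, h2] at h
  exact_mod_cast h

theorem sum_sq_norm_row {n : ℕ} {U : Matrix (Fin n) (Fin n) ℂ}
    (hU : U ∈ Matrix.unitaryGroup (Fin n) ℂ) (i : Fin n) : ∑ j, ‖U i j‖ ^ 2 = 1 := by
  -- Row `i` of `U` is `Uᵀ` applied to a basis vector.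
  have h := sum_sq_norm_mulVec (transpose_mem_unitary hU) (Pi.single i 1)
  simpa [Pi.single_apply, apply_ite, ite_pow] using h

theorem sum_sq_norm_compression_le {n : ℕ} {U : Matrix (Fin n) (Fin n) ℂ}
    (hU : U ∈ Matrix.unitaryGroup (Fin n) ℂ) (S T : Finset (Fin n)) (x : Fin n → ℂ) :
    ∑ i ∈ S, ‖∑ j ∈ T, U i j * x j‖ ^ 2 ≤ ∑ j ∈ T, ‖x j‖ ^ 2 := by
  classical
  have h := sum_sq_norm_mulVec hU (fun j => if j ∈ T then x j else 0)
  simp only [mul_ite, mul_zero, apply_ite norm, norm_zero, ite_pow, ne_eq, OfNat.ofNat_ne_zero,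
    not_false_eq_true, zero_pow, Finset.sum_ite_mem, Finset.univ_inter] at h
  rw [← h]
  exact Finset.sum_le_sum_of_subset_of_nonneg (Finset.subset_univ _) fun _ _ _ => by positivity

/-- The `(a, b)` entry of `U P Vᵀ`, where `P` is the coordinate projection onto `S`. -/
noncomputable def partialEntry {n : ℕ} (U V : Matrix (Fin n) (Fin n) ℂ) (S : Finset (Fin n))
    (a b : Fin n) : ℂ :=
  ∑ s ∈ S, U a s * V b s

theorem partialEntry_comm {n : ℕ} (U V : Matrix (Fin n) (Fin n) ℂ) (S : Finset (Fin n))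
    (a b : Fin n) : partialEntry U V S a b = partialEntry V U S b a :=
  Finset.sum_congr rfl fun _ _ => mul_comm _ _

theorem sum_sq_norm_partialEntry_le {n : ℕ} {U V : Matrix (Fin n) (Fin n) ℂ}
    (hU : U ∈ Matrix.unitaryGroup (Fin n) ℂ) (hV : V ∈ Matrix.unitaryGroup (Fin n) ℂ)
    (S Q : Finset (Fin n)) (a : Fin n) : ∑ b ∈ Q, ‖partialEntry U V S a b‖ ^ 2 ≤ 1 := by
  have hcomm : ∀ b, partialEntry U V S a b = ∑ s ∈ S, V b s * U a s := fun b =>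
    partialEntry_comm U V S a b
  simp only [hcomm]
  refine (sum_sq_norm_compression_le hV Q S _).trans ?_
  rw [← sum_sq_norm_row hU a]
  exact Finset.sum_le_sum_of_subset_of_nonneg (Finset.subset_univ _) fun _ _ _ => by positivity

theorem norm_mul_le_half (x y : ℂ) : ‖x * y‖ ≤ (‖x‖ ^ 2 + ‖y‖ ^ 2) / 2 := by
  rw [norm_mul]; nlinarith [sq_nonneg (‖x‖ - ‖y‖)]

/-! ### Bounds for the truncated form -/

/-- The trace pairing of a Hadamard product of `G` with two truncated unitary products. -/
noncomputable def truncatedForm {n : ℕ} (G U V W Z : Matrix (Fin n) (Fin n) ℂ)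
    (P Q S K : Finset (Fin n)) : ℂ :=
  ∑ a ∈ P, ∑ b ∈ Q, G a b * (partialEntry U V S a b * partialEntry W Z K a b)

section bounds

variable {n : ℕ} {G U V W Z : Matrix (Fin n) (Fin n) ℂ}

theorem truncatedForm_swap (P Q S K : Finset (Fin n)) :
    truncatedForm G U V W Z P Q S K = truncatedForm G W Z U V P Q K S := by
  simp only [truncatedForm, mul_comm (partialEntry U V _ _ _)]

theorem truncatedForm_transpose (P Q S K : Finset (Fin n)) :
    truncatedForm G U V W Z P Q S K = truncatedForm Gᵀ V U Z W Q P S K := by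
  simp only [truncatedForm, partialEntry_comm U V, partialEntry_comm W Z, Matrix.transpose_apply]
  exact Finset.sum_comm

/-- Each row contributes at most 1: `G` has entries bounded by 1, and both families of partial
entries have square sum at most 1 along a row. -/
theorem norm_truncatedForm_le_card_rows (hG : ∀ a b, ‖G a b‖ ≤ 1)
    (hU : U ∈ Matrix.unitaryGroup (Fin n) ℂ) (hV : V ∈ Matrix.unitaryGroup (Fin n) ℂ)
    (hW : W ∈ Matrix.unitaryGroup (Fin n) ℂ) (hZ : Z ∈ Matrix.unitaryGroup (Fin n) ℂ)
    (P Q S K : Finset (Fin n)) : ‖truncatedForm G U V W Z P Q S K‖ ≤ P.card := by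
  have hrow : ∀ a ∈ P,
      ‖∑ b ∈ Q, G a b * (partialEntry U V S a b * partialEntry W Z K a b)‖ ≤ 1 := by
    intro a _
    calc _ ≤ ∑ b ∈ Q, (‖partialEntry U V S a b‖ ^ 2 + ‖partialEntry W Z K a b‖ ^ 2) / 2 := by
          refine norm_sum_le_of_le _ fun b _ => ?_
          rw [norm_mul]
          exact (mul_le_of_le_one_left (norm_nonneg _) (hG a b)).trans (norm_mul_le_half _ _)
      _ ≤ 1 := by
          rw [← Finset.sum_div, Finset.sum_add_distrib]
          linarith [sum_sq_norm_partialEntry_le hU hV S Q a,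
            sum_sq_norm_partialEntry_le hW hZ K Q a]
  simpa [truncatedForm] using norm_sum_le_of_le P hrow

/-- For each `l`, compressing by `Wᵀ` does not increase the norm of `a ↦ X l a * U a s`. Summing
over `l` leaves the column bound for `X` and the unit column `s` of `U`. -/
theorem sum_sq_norm_weighted_le {X : Matrix (Fin n) (Fin n) ℂ}
    (hX : ∀ a, ∑ l, ‖X l a‖ ^ 2 ≤ 1)
    (hU : U ∈ Matrix.unitaryGroup (Fin n) ℂ) (hW : W ∈ Matrix.unitaryGroup (Fin n) ℂ)
    (P K : Finset (Fin n)) (s : Fin n) :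
    ∑ l, ∑ t ∈ K, ‖∑ a ∈ P, W a t * (X l a * U a s)‖ ^ 2 ≤ 1 := by
  calc _ ≤ ∑ l, ∑ a ∈ P, ‖X l a * U a s‖ ^ 2 := Finset.sum_le_sum fun l _ =>
        sum_sq_norm_compression_le (transpose_mem_unitary hW) K P _
    _ = ∑ a ∈ P, (∑ l, ‖X l a‖ ^ 2) * ‖U a s‖ ^ 2 := by
        rw [Finset.sum_comm]; simp only [norm_mul, mul_pow, Finset.sum_mul]
    _ ≤ ∑ a ∈ P, ‖U a s‖ ^ 2 := Finset.sum_le_sum fun a _ =>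
        mul_le_of_le_one_left (by positivity) (hX a)
    _ ≤ ∑ a, ‖U a s‖ ^ 2 :=
        Finset.sum_le_sum_of_subset_of_nonneg (Finset.subset_univ _) fun _ _ _ => by positivity
    _ = 1 := sum_sq_norm_row (transpose_mem_unitary hU) s

/-- After interchanging sums, each `s` contributes a pairing of two vectors indexed by `(l, t)`,
both in the unit ball by `sum_sq_norm_weighted_le`. -/
theorem norm_truncatedForm_le_card_rank {X Y : Matrix (Fin n) (Fin n) ℂ}
    (hX : ∀ a, ∑ l, ‖X l a‖ ^ 2 ≤ 1) (hY : ∀ a, ∑ l, ‖Y l a‖ ^ 2 ≤ 1)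
    (hU : U ∈ Matrix.unitaryGroup (Fin n) ℂ) (hV : V ∈ Matrix.unitaryGroup (Fin n) ℂ)
    (hW : W ∈ Matrix.unitaryGroup (Fin n) ℂ) (hZ : Z ∈ Matrix.unitaryGroup (Fin n) ℂ)
    (P Q S K : Finset (Fin n)) : ‖truncatedForm (Xᵀ * Y) U V W Z P Q S K‖ ≤ S.card := by
  have hform : truncatedForm (Xᵀ * Y) U V W Z P Q S K = ∑ s ∈ S, ∑ l, ∑ t ∈ K,
      (∑ a ∈ P, W a t * (X l a * U a s)) * (∑ b ∈ Q, Z b t * (Y l b * V b s)) := by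
    simp only [truncatedForm, partialEntry, Matrix.mul_apply, Matrix.transpose_apply,
      Finset.sum_mul_sum]
    simp only [Finset.mul_sum]
    calc _ = ∑ a ∈ P, ∑ b ∈ Q, ∑ s ∈ S, ∑ l, ∑ t ∈ K,
          W a t * (X l a * U a s) * (Z b t * (Y l b * V b s)) := by
          refine Finset.sum_congr rfl fun a _ => Finset.sum_congr rfl fun b _ => ?_
          rw [Finset.sum_comm]
          refine Finset.sum_congr rfl fun s _ => Finset.sum_congr rfl fun l _ =>
            Finset.sum_congr rfl fun t _ => ?_
          ring
      _ = ∑ a ∈ P, ∑ s ∈ S, ∑ l, ∑ t ∈ K, ∑ b ∈ Q,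
          W a t * (X l a * U a s) * (Z b t * (Y l b * V b s)) := by
          refine Finset.sum_congr rfl fun a _ => ?_
          rw [Finset.sum_comm]
          refine Finset.sum_congr rfl fun s _ => ?_
          rw [Finset.sum_comm]
          exact Finset.sum_congr rfl fun l _ => Finset.sum_comm
      _ = _ := by
          rw [Finset.sum_comm]
          refine Finset.sum_congr rfl fun s _ => ?_
          rw [Finset.sum_comm]
          exact Finset.sum_congr rfl fun l _ => Finset.sum_comm
  have hterm : ∀ s ∈ S, ‖∑ l, ∑ t ∈ K,
      (∑ a ∈ P, W a t * (X l a * U a s)) * (∑ b ∈ Q, Z b t * (Y l b * V b s))‖ ≤ 1 := by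
    intro s _
    calc _ ≤ ∑ l, ∑ t ∈ K, (‖∑ a ∈ P, W a t * (X l a * U a s)‖ ^ 2 +
            ‖∑ b ∈ Q, Z b t * (Y l b * V b s)‖ ^ 2) / 2 :=
          norm_sum_le_of_le _ fun l _ => norm_sum_le_of_le _ fun t _ => norm_mul_le_half _ _
      _ ≤ 1 := by
          simp only [← Finset.sum_div, Finset.sum_add_distrib]
          linarith [sum_sq_norm_weighted_le hX hU hW P K s,
            sum_sq_norm_weighted_le hY hV hZ Q K s]
  rw [hform]
  simpa using norm_sum_le_of_le S hterm

theorem norm_transpose_mul_apply_le {X Y : Matrix (Fin n) (Fin n) ℂ}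
    (hX : ∀ a, ∑ l, ‖X l a‖ ^ 2 ≤ 1) (hY : ∀ a, ∑ l, ‖Y l a‖ ^ 2 ≤ 1) (a b : Fin n) :
    ‖(Xᵀ * Y) a b‖ ≤ 1 := by
  rw [Matrix.mul_apply]
  calc _ ≤ ∑ l, (‖X l a‖ ^ 2 + ‖Y l b‖ ^ 2) / 2 :=
        norm_sum_le_of_le _ fun l _ => norm_mul_le_half _ _
    _ ≤ 1 := by
        rw [← Finset.sum_div, Finset.sum_add_distrib]
        linarith [hX a, hY b]

theorem norm_truncatedForm_le_min {X Y : Matrix (Fin n) (Fin n) ℂ}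
    (hX : ∀ a, ∑ l, ‖X l a‖ ^ 2 ≤ 1) (hY : ∀ a, ∑ l, ‖Y l a‖ ^ 2 ≤ 1)
    (hU : U ∈ Matrix.unitaryGroup (Fin n) ℂ) (hV : V ∈ Matrix.unitaryGroup (Fin n) ℂ)
    (hW : W ∈ Matrix.unitaryGroup (Fin n) ℂ) (hZ : Z ∈ Matrix.unitaryGroup (Fin n) ℂ)
    (P Q S K : Finset (Fin n)) : ‖truncatedForm (Xᵀ * Y) U V W Z P Q S K‖ ≤
      (min (min P.card Q.card) (min S.card K.card) : ℕ) := by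
  have hG := norm_transpose_mul_apply_le hX hY
  push_cast
  refine le_min (le_min ?_ ?_) (le_min ?_ ?_)
  · exact norm_truncatedForm_le_card_rows hG hU hV hW hZ P Q S K
  · rw [truncatedForm_transpose]
    exact norm_truncatedForm_le_card_rows (fun a b => hG b a) hV hU hZ hW Q P S K
  · exact norm_truncatedForm_le_card_rank hX hY hU hV hW hZ P Q S K
  · rw [truncatedForm_swap]
    exact norm_truncatedForm_le_card_rank hX hY hW hZ hU hV P Q K S

end bounds

/-! ### Layer expansions of both sides -/

theorem sum_smul_layers {ι κ E : Type*} [Fintype ι] [DecidableEq ι] [AddCommGroup E] [Module ℝ E]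
    (I : Finset κ) (P : κ → Finset ι) (δ : κ → ℝ) {x : ι → ℝ}
    (hx : ∀ i, x i = ∑ p ∈ I, if i ∈ P p then δ p else 0) (f : ι → E) :
    ∑ i, x i • f i = ∑ p ∈ I, δ p • ∑ i ∈ P p, f i := by
  simp only [hx, Finset.sum_smul, Finset.smul_sum]
  rw [Finset.sum_comm]
  refine Finset.sum_congr rfl fun p _ => ?_
  simp [ite_smul, Finset.sum_ite_mem]

/-- Layer-cake expansion of a trilinear sum. -/
theorem sum_smul_layers_three {ι κ E : Type*} [Fintype ι] [DecidableEq ι] [AddCommGroup E]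
    [Module ℝ E] (I : Finset κ) (P Q S : κ → Finset ι) (δ ε β : κ → ℝ) {x y z : ι → ℝ}
    (hx : ∀ i, x i = ∑ p ∈ I, if i ∈ P p then δ p else 0)
    (hy : ∀ i, y i = ∑ p ∈ I, if i ∈ Q p then ε p else 0)
    (hz : ∀ i, z i = ∑ p ∈ I, if i ∈ S p then β p else 0) (H : ι → ι → ι → E) :
    ∑ a, x a • ∑ b, y b • ∑ s, z s • H a b s =
      ∑ p ∈ I, ∑ q ∈ I, ∑ r ∈ I,
        (δ p * ε q * β r) • ∑ a ∈ P p, ∑ b ∈ Q q, ∑ s ∈ S r, H a b s := by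
  simp only [sum_smul_layers I P δ hx, sum_smul_layers I Q ε hy, sum_smul_layers I S β hz]
  refine Finset.sum_congr rfl fun p _ => ?_
  rw [Finset.sum_comm, Finset.smul_sum]
  refine Finset.sum_congr rfl fun q _ => ?_
  simp only [← Finset.smul_sum]
  rw [smul_smul]
  have : ∑ a ∈ P p, ∑ b ∈ Q q, ∑ r ∈ I, β r • ∑ s ∈ S r, H a b s =
      ∑ r ∈ I, β r • ∑ a ∈ P p, ∑ b ∈ Q q, ∑ s ∈ S r, H a b s := by
    simp only [Finset.smul_sum]
    rw [Finset.sum_comm (s := I)]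
    exact Finset.sum_congr rfl fun a _ => Finset.sum_comm
  rw [this, Finset.smul_sum]
  simp only [smul_smul]

theorem matrixSingularValue_antitone {n : ℕ} (B : Matrix (Fin n) (Fin n) ℂ) :
    Antitone (matrixSingularValue B) := fun _ _ h =>
  (Matrix.toEuclideanLin B).singularValues_antitone h

theorem matrixSingularValue_nonneg {n : ℕ} (B : Matrix (Fin n) (Fin n) ℂ) (i : Fin n) :
    0 ≤ matrixSingularValue B i :=
  (Matrix.toEuclideanLin B).singularValues_nonneg i

/-- Layer-cake decomposition of the column lengths into sets of longest columns. -/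
theorem exists_columnLength_layers {n : ℕ} (X : Matrix (Fin n) (Fin n) ℂ) :
    ∃ (δ : ℕ → ℝ) (P : ℕ → Finset (Fin n)), (∀ p, 0 ≤ δ p) ∧
      (∀ p, (P p).card = (initialSegment n (p + 1)).card) ∧
      (∀ a, columnLength X a = ∑ p ∈ Finset.range n, if a ∈ P p then δ p else 0) ∧
      ∀ i, orderedColumnLength X i =
        ∑ p ∈ Finset.range n, if i ∈ initialSegment n (p + 1) then δ p else 0 := by
  obtain ⟨δ, hδ, h⟩ := exists_layer_decomposition _ (orderedColumnLength_antitone X)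
    (fun i => norm_nonneg _)
  set π := Tuple.sort (fun j => -columnLength X j)
  refine ⟨δ, fun p => (initialSegment n (p + 1)).map π.toEmbedding, hδ,
    fun p => Finset.card_map _, fun a => ?_, h⟩
  have ha := h (π.symm a)
  simp only [Finset.mem_map_equiv]
  rw [← ha]
  change _ = columnLength X (π (π.symm a))
  rw [Equiv.apply_symm_apply]

theorem exists_normalized_columns {n : ℕ} (X : Matrix (Fin n) (Fin n) ℂ) :
    ∃ X' : Matrix (Fin n) (Fin n) ℂ, (∀ a, ∑ l, ‖X' l a‖ ^ 2 ≤ 1) ∧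
      ∀ l a, X l a = columnLength X a * X' l a := by
  have hsq : ∀ a, columnLength X a ^ 2 = ∑ l, ‖X l a‖ ^ 2 := fun a => by
    rw [columnLength_eq, Real.sq_sqrt (by positivity)]
  -- Since `0⁻¹ = 0`, a zero column stays zero; this is why the bound is `≤ 1`, not equality.
  refine ⟨fun l a => (columnLength X a : ℂ)⁻¹ * X l a, fun a => ?_, fun l a => ?_⟩
  · simp only [norm_mul, mul_pow, ← Finset.mul_sum, ← hsq, norm_inv, Complex.norm_real,
      Real.norm_eq_abs, inv_pow, sq_abs]
    exact inv_mul_le_one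
  · by_cases h : columnLength X a = 0
    · have h1 := hsq a
      rw [h, zero_pow two_ne_zero, eq_comm,
        Finset.sum_eq_zero_iff_of_nonneg (fun _ _ => by positivity)] at h1
      have := h1 l (Finset.mem_univ l)
      simp only [ne_eq, OfNat.ofNat_ne_zero, not_false_eq_true, pow_eq_zero_iff,
        norm_eq_zero] at this
      simp [this]
    · rw [mul_inv_cancel_left₀ (by exact_mod_cast h)]

/-- Only diagonal triples count, and initial segments are nested, so their intersection is the
smallest of them. -/
theorem card_diagonal_layers (n p q r k : ℕ) :
    ∑ a ∈ initialSegment n p, ∑ b ∈ initialSegment n q, ∑ s ∈ initialSegment n r,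
      (if a = b ∧ b = s ∧ a ∈ initialSegment n k then (1 : ℝ) else 0) =
    (min (min (initialSegment n p).card (initialSegment n q).card)
      (min (initialSegment n r).card (initialSegment n k).card) : ℕ) := by
  have hmono : Monotone fun p => (initialSegment n p).card := fun p q h =>
    Finset.card_le_card fun i hi => mem_initialSegment.2 ((mem_initialSegment.1 hi).trans_le h)
  have hmin : ∀ p q, min (initialSegment n p).card (initialSegment n q).card =
      (initialSegment n (min p q)).card := fun p q => (hmono.map_min).symm
  rw [hmin, hmin, hmin, ← initialSegment_inter, ← initialSegment_inter, ← initialSegment_inter]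
  have h : ∀ a b s : Fin n, (if a = b ∧ b = s ∧ a ∈ initialSegment n k then (1 : ℝ) else 0) =
      if a = b then (if b = s then (if a ∈ initialSegment n k then 1 else 0) else 0) else 0 := by
    intro a b s; split_ifs <;> simp_all
  simp only [h, Finset.sum_ite_eq, Finset.sum_ite_irrel, Finset.sum_const_zero]
  simp only [← ite_and, ← Finset.sum_filter, Finset.sum_const, nsmul_eq_mul, mul_one, Nat.cast_inj]
  congr 1
  ext i
  simp only [Finset.mem_filter, Finset.mem_inter]
  tauto

theorem sum_fin_castLE_eq {n k : ℕ} (hkn : k ≤ n) (f : Fin n → ℝ) :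
    ∑ i : Fin k, f (Fin.castLE hkn i) = ∑ i ∈ initialSegment n k, f i := by
  refine Finset.sum_bij (fun i _ => Fin.castLE hkn i) (fun i _ => ?_) (fun i _ j _ h => ?_)
    (fun i hi => ?_) fun _ _ => rfl
  · simp [mem_initialSegment]
  · simpa using h
  · exact ⟨⟨i, mem_initialSegment.1 hi⟩, Finset.mem_univ _, rfl⟩

/-- Partial sums of singular values are given by pairing with a truncated unitary product. -/
theorem exists_sum_singularValue_eq {n : ℕ} (M : Matrix (Fin n) (Fin n) ℂ) :
    ∃ W ∈ Matrix.unitaryGroup (Fin n) ℂ, ∃ Z ∈ Matrix.unitaryGroup (Fin n) ℂ,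
      ∀ K : Finset (Fin n), ((∑ t ∈ K, matrixSingularValue M t : ℝ) : ℂ) =
        ∑ a, ∑ b, M a b * partialEntry W Z K a b := by
  obtain ⟨U, hU, V, hV, h⟩ := exists_svd M
  -- Entrywise conjugates appear because `M = U D Vᵀ` gives `D = U* M V̄`, read off on the diagonal.
  refine ⟨_, map_star_mem_unitary hU, _, map_star_mem_unitary hV, fun K => ?_⟩
  have hV' : Vᵀ * V.map star = 1 :=
    (Matrix.mem_unitaryGroup_iff.1 (transpose_mem_unitary hV))
  have hd : star U * M * V.map star =
      Matrix.diagonal (fun i => (matrixSingularValue M i : ℂ)) := by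
    generalize Matrix.diagonal (fun i => (matrixSingularValue M i : ℂ)) = D at h ⊢
    rw [h, mul_assoc, mul_assoc, hV', mul_one, ← mul_assoc,
      Matrix.mem_unitaryGroup_iff'.1 hU, one_mul]
  have ht : ∀ t, (matrixSingularValue M t : ℂ) =
      ∑ a, ∑ b, M a b * (U.map star a t * V.map star b t) := by
    intro t
    have h1 := congrFun (congrFun hd t) t
    rw [Matrix.diagonal_apply_eq] at h1
    rw [← h1]
    simp only [Matrix.mul_apply, Finset.sum_mul, Matrix.star_apply, Matrix.map_apply]
    rw [Finset.sum_comm]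
    exact Finset.sum_congr rfl fun a _ => Finset.sum_congr rfl fun b _ => by ring
  push_cast
  simp only [ht, partialEntry, Finset.mul_sum]
  rw [Finset.sum_comm]
  exact Finset.sum_congr rfl fun a _ => Finset.sum_comm

/-- The Ando–Horn–Johnson inequality. -/
theorem theorem3p3 (n : ℕ) (A B X Y : Matrix (Fin n) (Fin n) ℂ) (hA : A = Xᴴ * Y)
    (k : ℕ) (hk1 : 1 ≤ k) (hkn : k ≤ n) :
    ∑ i : Fin k, matrixSingularValue (A ⊙ B) (Fin.castLE hkn i) ≤
      ∑ i : Fin k, orderedColumnLength X (Fin.castLE hkn i) *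
        orderedColumnLength Y (Fin.castLE hkn i) *
        matrixSingularValue B (Fin.castLE hkn i) := by
  obtain ⟨X', hX', hX⟩ := exists_normalized_columns X
  obtain ⟨Y', hY', hY⟩ := exists_normalized_columns Y
  obtain ⟨δ, P, hδ, hPc, hP, hPo⟩ := exists_columnLength_layers X
  obtain ⟨ε, Q, hε, hQc, hQ, hQo⟩ := exists_columnLength_layers Y
  obtain ⟨β, hβ, hS⟩ := exists_layer_decomposition _ (matrixSingularValue_antitone B)
    (matrixSingularValue_nonneg B)
  obtain ⟨U, hU, V, hV, hB⟩ := exists_svd B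
  obtain ⟨W, hW, Z, hZ, hM⟩ := exists_sum_singularValue_eq (A ⊙ B)
  set K := initialSegment n k
  -- Conjugating `X'` turns the adjoint into the plain transpose of the bounds, without changing
  -- norms.
  set G := (X'.map star)ᵀ * Y' with hG
  have hX'' : ∀ a, ∑ l, ‖X'.map star l a‖ ^ 2 ≤ 1 := by simpa using hX'
  have hAe : ∀ a b, A a b = columnLength X a * columnLength Y b * G a b := by
    intro a b
    simp only [hA, hG, Matrix.mul_apply, Matrix.conjTranspose_apply, Matrix.transpose_apply,
      Matrix.map_apply, hX _ a, hY _ b, Finset.mul_sum, star_mul', Complex.star_def,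
      Complex.conj_ofReal]
    exact Finset.sum_congr rfl fun l _ => by ring
  have hBe : ∀ a b, B a b = ∑ s, (matrixSingularValue B s : ℂ) * (U a s * V b s) := by
    intro a b
    have h := congrFun (congrFun hB a) b
    rw [h]
    simp only [Matrix.mul_apply (M := U * _), Matrix.mul_diagonal, Matrix.transpose_apply]
    exact Finset.sum_congr rfl fun s _ => by ring
  have hl : ((∑ t ∈ K, matrixSingularValue (A ⊙ B) t : ℝ) : ℂ) =
      ∑ p ∈ Finset.range n, ∑ q ∈ Finset.range n, ∑ r ∈ Finset.range n,
        (δ p * ε q * β r) • truncatedForm G U V W Z (P p) (Q q) (initialSegment n (r + 1)) K := by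
    have h := sum_smul_layers_three (Finset.range n) P Q (fun r => initialSegment n (r + 1))
      δ ε β hP hQ hS (fun a b s => G a b * (U a s * V b s * partialEntry W Z K a b))
    simp only [← Finset.mul_sum, ← Finset.sum_mul] at h
    refine Eq.trans ?_ h
    rw [hM]
    simp only [Matrix.hadamard_apply, hAe, hBe, Finset.smul_sum, Complex.real_smul,
      Finset.mul_sum, Finset.sum_mul]
    refine Finset.sum_congr rfl fun a _ => Finset.sum_congr rfl fun b _ =>
      Finset.sum_congr rfl fun s _ => ?_
    ring
  have hr : ∑ i ∈ K, orderedColumnLength X i * orderedColumnLength Y i * matrixSingularValue B i =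
      ∑ p ∈ Finset.range n, ∑ q ∈ Finset.range n, ∑ r ∈ Finset.range n, (δ p * ε q * β r) *
        (min (min (P p).card (Q q).card) (min (initialSegment n (r + 1)).card K.card) : ℕ) := by
    have h := sum_smul_layers_three (Finset.range n) (fun r => initialSegment n (r + 1))
      (fun r => initialSegment n (r + 1)) (fun r => initialSegment n (r + 1))
      -- This kernel restricts the trilinear sum to the diagonal inside `K`.
      δ ε β hPo hQo hS (fun a b s => if a = b ∧ b = s ∧ a ∈ K then (1 : ℝ) else 0)
    simp only [K, card_diagonal_layers] at h
    simp only [hPc, hQc, K]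
    refine Eq.trans ?_ h
    simp [ite_and, Finset.sum_ite_irrel, Finset.sum_ite_mem, mul_assoc]
  rw [sum_fin_castLE_eq hkn (matrixSingularValue (A ⊙ B)), sum_fin_castLE_eq hkn fun i =>
    orderedColumnLength X i * orderedColumnLength Y i * matrixSingularValue B i, hr]
  refine (Real.le_norm_self _).trans ?_
  rw [← Complex.norm_real, hl]
  refine norm_sum_le_of_le _ fun p _ => norm_sum_le_of_le _ fun q _ =>
    norm_sum_le_of_le _ fun r _ => ?_
  have h0 : 0 ≤ δ p * ε q * β r := mul_nonneg (mul_nonneg (hδ p) (hε q)) (hβ r)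
  rw [norm_smul, Real.norm_of_nonneg h0]
  exact mul_le_mul_of_nonneg_left
    (norm_truncatedForm_le_min hX'' hY' hU hV hW hZ _ _ _ _) h0
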